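/- Let $n \in \mathbb{N}_0$ and let $p, q$ be integers with $q \geq p \geq 1$. Let $S$ be a compact topological space and let $f_s : \mathbb{R}^n \to \mathbb{R}$, $s \in S$, be $\mathcal{C}^{q+1}$ functions such that $f_s(x)$ and all partial derivatives of $f_s$ at $x$ up to order $q+1$ depend continuously on $(s,x) \in S \times \mathbb{R}^n$. Let $f(x) = \max_{s \in S} f_s(x)$ for all $x \in \mathbb{R}^n$ (in particular, the maximum is attained), and for each $y \in \mathbb{R}^n$ let $s(y) \in S$ be an index with $f_{s(y)}(y) = f(y)$. Write $\bar B_\Delta(x)$ for the closed Euclidean ball, and set $$\Lambda^p(x,\Delta) := \frac{f(x) - \min_{z \in \bar B_\Delta(x)} f(z)}{\Delta^p}, \qquad \mathcal{T}^{q,W}(z) := \max_{y \in W} \sum_{m=0}^q \frac{1}{m!} D^m f_{s(y)}(y)(z-y)^m$$ for $\Delta > 0$ and finite nonempty $W \subseteq \mathbb{R}^n$. Let $(\Delta_j)_{j \geq 1}$, $(\tau_j)_{j \geq 1}$ be sequences of positive reals that converge to $0$, let $\sigma \in (0,1)$, $c > 0$ and $x^0 \in \mathbb{R}^n$, and consider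 the following method. Start with $x^{1,0} = x^0$. For $j = 1, 2, \dots$ run the following inner loop over $i = 0, 1, \dots$: 1. Start with $W = \{x^{j,i}\}$. Compute any minimizer $\bar z$ of $\mathcal{T}^{q,W}$ over $\bar B_{\Delta_j}(x^{j,i})$. While $f(\bar z) - \mathcal{T}^{q,W}(\bar z) > \min(\Delta_j^{q+\sigma}, c)$, replace $W$ by $W \cup \{\bar z\}$ and compute any minimizer $\bar z$ for the new $W$. 2. With the last $\bar z$ computed in 1.: if $(f(x^{j,i}) - f(\bar z))/\Delta_j^p < \tau_j$, leave the inner loop and set $x^j := x^{j+1,0} := x^{j,i}$. Otherwise set $x^{j,i+1} := \bar z$ and continue the inner loop. Assume that the sublevel set $\{x \in \mathbb{R}^n : f(x) \leq f(x^0)\}$ is bounded. Then the method is well-defined: it can be carried out, and for every choice of the minimizers $\bar z$ all loops in step 1 and all inner loops are finite, so that it generates an infinite sequence $(x^j)_{j \geq 1}$. Every sequence generated in this way satisfies $$\lim_{j \to \infty} \Lambda^p(x^j,\Delta_j) = 0.$$ Furthermore, $(x^j)_j$ has an accumulation point, and every accumulation point $\bar x$ of $(x^j)_j$ is a critical point of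 $f$, i.e., $0 \in \partial f(\bar x)$, where $\partial f(\bar x)$ is the Clarke subdifferential, $\partial f(\bar x) = \{ g \in \mathbb{R}^n : \langle g, v \rangle \leq \limsup_{y \to \bar x,\, t \downarrow 0} (f(y+tv)-f(y))/t \ \text{for all } v \in \mathbb{R}^n \}$. -/

import Mathlib

open Filter Topology

noncomputable section

namespace TRBundle

/-- Euclidean space `ℝⁿ` with the Euclidean norm. -/
abbrev Rn (n : ℕ) : Type := EuclideanSpace ℝ (Fin n)

/-- The generalized directional derivative of Clarke,
`f°(x; v) = limsup_{y → x, t ↓ 0} (f (y + t v) - f y) / t`, taken in the extended reals so that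
no boundedness is needed for it to make sense. -/
def clarkeDeriv {n : ℕ} (f : Rn n → ℝ) (x v : Rn n) : EReal :=
  limsup (fun a : Rn n × ℝ => (((f (a.1 + a.2 • v) - f a.1) / a.2 : ℝ) : EReal))
    (𝓝 x ×ˢ 𝓝[>] (0 : ℝ))

/-- The Clarke subdifferential `∂f(x) = {g : ⟨g, v⟩ ≤ f°(x; v) for all v}`. -/
def clarkeSubdiff {n : ℕ} (f : Rn n → ℝ) (x : Rn n) : Set (Rn n) :=
  {g | ∀ v : Rn n, ((inner ℝ g v : ℝ) : EReal) ≤ clarkeDeriv f x v}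

/-- `x` is a (Clarke) critical point of `f`. -/
def IsCritical {n : ℕ} (f : Rn n → ℝ) (x : Rn n) : Prop :=
  (0 : Rn n) ∈ clarkeSubdiff f x

/-- `f` is the pointwise maximum of the `C^{q+1}` selection functions `φ s`, `s ∈ S`, whose values
and derivatives up to order `q + 1` depend continuously on `(s, x)`. (The `m`-th derivative is an
`m`-linear form on `ℝⁿ`, with the partial derivatives of order `m` as its coefficients; it is
continuous in `(s, x)` iff all of these are.) Compactness of `S` is required separately. -/
structure IsMaxRepr {n : ℕ} {S : Type*} [TopologicalSpace S] (q : ℕ)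
    (φ : S → Rn n → ℝ) (f : Rn n → ℝ) : Prop where
  contDiff : ∀ s, ContDiff ℝ (q + 1) (φ s)
  continuous_deriv : ∀ m : ℕ, m ≤ q + 1 →
    Continuous fun a : S × Rn n => iteratedFDeriv ℝ m (φ a.1) a.2
  isGreatest : ∀ x, IsGreatest (Set.range fun s => φ s x) (f x)

/-- `s x` is an active index at every point `x`. -/
def IsActiveSelection {n : ℕ} {S : Type*} (φ : S → Rn n → ℝ) (f : Rn n → ℝ)
    (s : Rn n → S) : Prop :=
  ∀ x, φ (s x) x = f x

/-- `Λ^p(x, Δ) = (f x - min_{z ∈ B̄_Δ(x)} f z) / Δ^p`. -/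
def Lam {n : ℕ} (f : Rn n → ℝ) (p : ℕ) (x : Rn n) (Δ : ℝ) : ℝ :=
  (f x - sInf (f '' Metric.closedBall x Δ)) / Δ ^ p

/-- `Λ^p(x, Δ)` is computed by any minimizer of `f` in the trust region. -/
theorem Lam_eq {n : ℕ} {f : Rn n → ℝ} {p : ℕ} {x z : Rn n} {Δ : ℝ}
    (hz : z ∈ Metric.closedBall x Δ) (hmin : IsMinOn f (Metric.closedBall x Δ) z) :
    Lam f p x Δ = (f x - f z) / Δ ^ p := by
  have h : IsLeast (f '' Metric.closedBall x Δ) (f z) :=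
    ⟨⟨z, hz, rfl⟩, by rintro _ ⟨y, hy, rfl⟩; exact hmin hy⟩
  rw [Lam, h.csInf_eq]

/-- The Taylor polynomial of order `q` of `g` at `y`, evaluated at `z`:
`T^q g(z, y) = ∑_{m ≤ q} D^m g(y)(z - y)^m / m!`. -/
def taylorPoly {n : ℕ} (q : ℕ) (g : Rn n → ℝ) (z y : Rn n) : ℝ :=
  ∑ m ∈ Finset.range (q + 1),
    ((m.factorial : ℝ))⁻¹ * iteratedFDeriv ℝ m g y (fun _ => z - y)

/-- The `q`-order cutting-plane model for the bundle `W`: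
`𝒯^{q,W}(z) = max_{y ∈ W} T^q f_{s(y)}(z, y)` (for finite nonempty `W`). -/
def model {n : ℕ} {S : Type*} (q : ℕ) (φ : S → Rn n → ℝ) (s : Rn n → S)
    (W : Finset (Rn n)) (z : Rn n) : ℝ :=
  ⨆ y : W, taylorPoly q (φ (s y)) z y

/-- `z` is a solution of the trust-region subproblem `min_{z ∈ B̄_Δ(x)} 𝒯^{q,W}(z)`. -/
def IsSubproblemSol {n : ℕ} {S : Type*} (q : ℕ) (φ : S → Rn n → ℝ) (s : Rn n → S)
    (W : Finset (Rn n)) (x : Rn n) (Δ : ℝ) (z : Rn n) : Prop :=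
  z ∈ Metric.closedBall x Δ ∧ IsMinOn (model q φ s W) (Metric.closedBall x Δ) z

/-- Stopping criterion of the bundle subroutine, at a solution `z` of the subproblem for `W`:
`f(z) - 𝒯^{q,W}(z) ≤ min (Δ^{q+σ}, c)`. -/
def ModelAccurate {n : ℕ} {S : Type*} (q : ℕ) (φ : S → Rn n → ℝ) (s : Rn n → S)
    (f : Rn n → ℝ) (σ c Δ : ℝ) (W : Finset (Rn n)) (z : Rn n) : Prop :=
  f z - model q φ s W z ≤ min (Δ ^ ((q : ℝ) + σ)) c

/-- State of the trust-region bundle method: the outer index `j`, the current iterate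
`x = x^{j,i}`, and the current bundle `W` of the subroutine that is running at `x^{j,i}`. -/
structure State (n : ℕ) where
  j : ℕ
  x : Rn n
  W : Finset (Rn n)

open Classical in
/-- One step of the method. A solution `z` of the subproblem for the current bundle is computed.
* If the stopping criterion of the subroutine fails at `z`, then `z` is added to the bundle.
* Otherwise the subroutine has returned `W` and `z`. If `(f x - f z) / Δ_j^p < τ_j`, the inner loop
  is left: the next outer iteration starts at the same point `x`, which is `x^j`.
* Otherwise `z` is the next inner iterate.

In the last two cases the subroutine restarts with the bundle that consists of the iterate only. -/
def Step {n : ℕ} {S : Type*} (p q : ℕ) (φ : S → Rn n → ℝ) (s : Rn n → S) (f : Rn n → ℝ)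
    (σ c : ℝ) (Δ τ : ℕ → ℝ) (a b : State n) : Prop :=
  ∃ z, IsSubproblemSol q φ s a.W a.x (Δ a.j) z ∧
    ((¬ ModelAccurate q φ s f σ c (Δ a.j) a.W z ∧ b = ⟨a.j, a.x, insert z a.W⟩) ∨
     (ModelAccurate q φ s f σ c (Δ a.j) a.W z ∧
        (f a.x - f z) / Δ a.j ^ p < τ a.j ∧ b = ⟨a.j + 1, a.x, {a.x}⟩) ∨
     (ModelAccurate q φ s f σ c (Δ a.j) a.W z ∧
        ¬ (f a.x - f z) / Δ a.j ^ p < τ a.j ∧ b = ⟨a.j, z, {z}⟩))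

/-- `e` is an execution of the method from the initial point `x⁰ = x^{1,0}`: it starts in outer
iteration `1` with the bundle `{x⁰}`, and goes on forever. -/
def IsExecution {n : ℕ} {S : Type*} (p q : ℕ) (φ : S → Rn n → ℝ) (s : Rn n → S)
    (f : Rn n → ℝ) (σ c : ℝ) (Δ τ : ℕ → ℝ) (x₀ : Rn n) (e : ℕ → State n) : Prop :=
  e 0 = ⟨1, x₀, {x₀}⟩ ∧ ∀ t, Step p q φ s f σ c Δ τ (e t) (e (t + 1))

/-- `y` is the outer iterate `x^j` of the execution `e`: the iterate at which the inner loop of the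
`j`-th outer iteration is left. -/
def IsOuterIterate {n : ℕ} (e : ℕ → State n) (j : ℕ) (y : Rn n) : Prop :=
  ∃ t, (e t).j = j ∧ (e (t + 1)).j = j + 1 ∧ (e t).x = y

end TRBundle

end

/-! Compactness of `S` and of balls makes the Taylor remainders of all selection functions uniformly
`O(‖z - y‖ ^ (q + 1))` on bounded sets, and everything rests on this bound.

Finiteness of the subroutine: each added point is badly modelled by the Taylor polynomials at all
earlier ones. The points lie in a compact ball, so two of them come arbitrarily close, and there the
later one is well modelled (`not_forall_inaccurate`). Finiteness of the inner loop: each accepted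
step lowers `f` by at least `τ_j Δ_j ^ p`, and `f` is bounded below on the sublevel set
(`exists_succ_j`).

At an exit, the model is accurate at its minimizer and exceeds `f` by at most `O(Δ ^ (q + 1))`
elsewhere in the ball. So the small decrease found bounds the best possible one, giving `Λ^p ≤ τ + Δ
^ σ + O(Δ)` (`Lam_le`). A direction of negative Clarke derivative at an accumulation point would
force a decrease of order `Δ`, contradicting `Λ^p → 0` (`isCritical_of_tendsto_Lam`). -/

namespace TRBundle

open Metric

/-! ### Taylor expansion with remainder -/

/-- The derivatives of a function along a line are its iterated derivatives in that direction. -/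
theorem iteratedDeriv_comp_line {E : Type*} [NormedAddCommGroup E] [NormedSpace ℝ E]
    {g : E → ℝ} {N : ℕ} (hg : ContDiff ℝ N g) (y v : E) {m : ℕ} (hm : m ≤ N) (t : ℝ) :
    iteratedDeriv m (fun t : ℝ => g (y + t • v)) t
      = iteratedFDeriv ℝ m g (y + t • v) (fun _ => v) := by
  let L : ℝ →L[ℝ] E := (ContinuousLinearMap.id ℝ ℝ).smulRight v
  have hG : ContDiff ℝ N (fun w => g (y + w)) := hg.comp (contDiff_const.add contDiff_id)
  have h := L.iteratedFDeriv_comp_right (i := m) hG t (by exact_mod_cast hm)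
  rw [iteratedDeriv_eq_iteratedFDeriv]
  change iteratedFDeriv ℝ m ((fun w => g (y + w)) ∘ L) t _ = _
  rw [h, ContinuousMultilinearMap.compContinuousLinearMap_apply, iteratedFDeriv_comp_add_left]
  simp [L]

/-- Taylor's theorem with a uniform bound on the derivative of order `q + 1` on a convex set. -/
theorem abs_sub_taylorPoly_le {n q : ℕ} {g : Rn n → ℝ} (hg : ContDiff ℝ (q + 1) g)
    {K : Set (Rn n)} (hK : Convex ℝ K) {C : ℝ}
    (hC : ∀ x ∈ K, ‖iteratedFDeriv ℝ (q + 1) g x‖ ≤ C) {y z : Rn n} (hy : y ∈ K) (hz : z ∈ K) :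
    |g z - taylorPoly q g z y| ≤ C * ‖z - y‖ ^ (q + 1) := by
  set v := z - y with hv
  let h : ℝ → ℝ := fun t => g (y + t • v)
  have hg' : ContDiff ℝ ((q + 1 : ℕ) : WithTop ℕ∞) g := by exact_mod_cast hg
  have hh : ContDiff ℝ (q + 1) h :=
    hg.comp (contDiff_const.add (contDiff_id.smul contDiff_const))
  have hder : ∀ m ≤ q + 1, ∀ t ∈ Set.Icc (0 : ℝ) 1,
      iteratedDerivWithin m h (Set.Icc 0 1) t
        = iteratedFDeriv ℝ m g (y + t • v) (fun _ => v) := by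
    intro m hm t ht
    rw [iteratedDerivWithin_eq_iteratedDeriv (uniqueDiffOn_Icc one_pos)
      ((hh.of_le (by exact_mod_cast hm)).contDiffAt) ht]
    exact iteratedDeriv_comp_line hg' y v hm t
  have hCv : 0 ≤ C * ‖v‖ ^ (q + 1) :=
    mul_nonneg ((norm_nonneg _).trans (hC y hy)) (by positivity)
  have key := taylor_mean_remainder_bound (n := q) (f := h) (a := 0) (b := 1) (x := 1)
    (C := C * ‖v‖ ^ (q + 1)) zero_le_one hh.contDiffOn (by simp) (by
      intro t ht
      rw [hder _ le_rfl t ht]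
      have hmem : y + t • v ∈ K := by
        have := hK.add_smul_sub_mem hy hz ht
        simpa [hv] using this
      refine ((iteratedFDeriv ℝ (q + 1) g (y + t • v)).le_opNorm _).trans ?_
      simp only [Finset.prod_const, Finset.card_univ, Fintype.card_fin]
      gcongr
      exact hC _ hmem)
  rw [taylor_within_apply] at key
  have hsum : ∑ k ∈ Finset.range (q + 1), (((k.factorial : ℝ))⁻¹ * (1 - 0) ^ k) •
      iteratedDerivWithin k h (Set.Icc 0 1) 0 = taylorPoly q g z y := by
    refine Finset.sum_congr rfl fun k hk => ?_
    rw [hder k (Finset.mem_range.1 hk).le 0 (by simp)]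
    simp [hv]
  rw [hsum] at key
  have h1 : h 1 = g z := by simp [h, hv]
  rw [h1, Real.norm_eq_abs] at key
  refine key.trans ?_
  simp only [sub_zero, one_pow, mul_one]
  -- The one-variable bound carries a factor `1 / q!`, which is dropped.
  exact div_le_self hCv (by exact_mod_cast q.factorial_pos)

theorem taylorPoly_zero {n : ℕ} (g : Rn n → ℝ) (z y : Rn n) : taylorPoly 0 g z y = g y := by
  simp [taylorPoly]

theorem continuous_taylorPoly {n : ℕ} (q : ℕ) (g : Rn n → ℝ) (y : Rn n) :
    Continuous fun z => taylorPoly q g z y := by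
  unfold taylorPoly
  refine continuous_finsetSum _ fun m _ => continuous_const.mul ?_
  exact (iteratedFDeriv ℝ m g y).cont.comp (continuous_pi fun _ => continuous_id.sub continuous_const)

/-! ### The cutting-plane model -/

section Model

variable {n : ℕ} {S : Type*} {q : ℕ} {φ : S → Rn n → ℝ}
  {s : Rn n → S} {W : Finset (Rn n)}

theorem taylorPoly_le_model {y : Rn n} (hy : y ∈ W) (z : Rn n) :
    taylorPoly q (φ (s y)) z y ≤ model q φ s W z :=
  le_ciSup (f := fun y : W => taylorPoly q (φ (s y)) z y) (Set.finite_range _).bddAbove ⟨y, hy⟩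

theorem model_le (hW : W.Nonempty) {z : Rn n} {b : ℝ}
    (h : ∀ y ∈ W, taylorPoly q (φ (s y)) z y ≤ b) : model q φ s W z ≤ b := by
  have := hW.to_subtype
  exact ciSup_le fun y => h y y.2

theorem continuous_model (hW : W.Nonempty) : Continuous (model q φ s W) := by
  have := hW.to_subtype
  have h : model q φ s W = fun z => Finset.univ.sup' Finset.univ_nonempty
      fun y : W => taylorPoly q (φ (s y)) z y := by
    funext z
    exact (Finset.sup'_univ_eq_ciSup _).symm
  rw [h]
  exact Continuous.finset_sup'_apply _ fun y _ => continuous_taylorPoly _ _ _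

theorem exists_isSubproblemSol (hW : W.Nonempty) (x : Rn n) {Δ : ℝ} (hΔ : 0 ≤ Δ) :
    ∃ z, IsSubproblemSol q φ s W x Δ z :=
  (isCompact_closedBall x Δ).exists_isMinOn ⟨x, mem_closedBall_self hΔ⟩
    (continuous_model hW).continuousOn

end Model

/-! ### Uniform estimates for max-functions -/

section MaxRepr

variable {n : ℕ} {S : Type*} [TopologicalSpace S] {q : ℕ} {φ : S → Rn n → ℝ} {f : Rn n → ℝ}

theorem IsMaxRepr.of_le (hf : IsMaxRepr q φ f) {r : ℕ} (hr : r ≤ q) : IsMaxRepr r φ f where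
  contDiff s := (hf.contDiff s).of_le (by gcongr)
  continuous_deriv m hm := hf.continuous_deriv m (by omega)
  isGreatest := hf.isGreatest

theorem IsMaxRepr.le (hf : IsMaxRepr q φ f) (s : S) (x : Rn n) : φ s x ≤ f x :=
  (hf.isGreatest x).2 ⟨s, rfl⟩

/-- The Taylor remainders of the selection functions are bounded uniformly on bounded sets. -/
theorem IsMaxRepr.exists_taylor_bound [CompactSpace S] (hf : IsMaxRepr q φ f) (R : ℝ) :
    ∃ C, 0 ≤ C ∧ ∀ s, ∀ y ∈ closedBall (0 : Rn n) R, ∀ z ∈ closedBall (0 : Rn n) R,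
      |φ s z - taylorPoly q (φ s) z y| ≤ C * ‖z - y‖ ^ (q + 1) := by
  obtain ⟨C, hC⟩ := ((isCompact_univ (X := S)).prod
    (isCompact_closedBall (0 : Rn n) R)).exists_bound_of_continuousOn
      (hf.continuous_deriv (q + 1) le_rfl).continuousOn
  -- For `R < 0` the ball is empty and `C` could be negative.
  refine ⟨max C 0, le_max_right _ _, fun s y hy z hz => ?_⟩
  exact abs_sub_taylorPoly_le (hf.contDiff s) (convex_closedBall _ _)
    (fun x hx => (hC (s, x) ⟨Set.mem_univ _, hx⟩).trans (le_max_left _ _)) hy hz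

/-- The selection functions are Lipschitz on bounded sets, uniformly in the index. -/
theorem IsMaxRepr.exists_lipschitz_bound [CompactSpace S] (hf : IsMaxRepr q φ f) (R : ℝ) :
    ∃ C, 0 ≤ C ∧ ∀ s, ∀ y ∈ closedBall (0 : Rn n) R, ∀ z ∈ closedBall (0 : Rn n) R,
      |φ s z - φ s y| ≤ C * ‖z - y‖ := by
  -- Order `0`: the Taylor polynomial is constant and the remainder bound is a Lipschitz bound.
  simpa [taylorPoly_zero] using (hf.of_le (Nat.zero_le q)).exists_taylor_bound R

theorem IsMaxRepr.sub_le_of_lipschitz (hf : IsMaxRepr q φ f) {R C : ℝ}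
    (hC : ∀ s, ∀ y ∈ closedBall (0 : Rn n) R, ∀ z ∈ closedBall (0 : Rn n) R,
      |φ s z - φ s y| ≤ C * ‖z - y‖) {y z : Rn n} (hy : y ∈ closedBall (0 : Rn n) R)
    (hz : z ∈ closedBall (0 : Rn n) R) : f z - f y ≤ C * ‖z - y‖ := by
  obtain ⟨s, hs⟩ := (hf.isGreatest z).1
  have h1 : φ s z = f z := hs
  have h2 := hf.le s y
  have h3 := (abs_le.1 (hC s y hy z hz)).2
  linarith

theorem IsMaxRepr.continuous [CompactSpace S] (hf : IsMaxRepr q φ f) : Continuous f := by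
  rw [continuous_iff_continuousAt]
  intro x
  obtain ⟨C, hC0, hC⟩ := hf.exists_lipschitz_bound (‖x‖ + 1)
  refine ContinuousOn.continuousAt (s := closedBall 0 (‖x‖ + 1)) ?_
    (mem_of_superset (isOpen_ball.mem_nhds (by simp)) ball_subset_closedBall)
  lift C to NNReal using hC0
  refine LipschitzOnWith.continuousOn (K := C)
    (LipschitzOnWith.of_dist_le_mul fun y hy z hz => ?_)
  rw [Real.dist_eq, dist_eq_norm, abs_le]
  have h1 := hf.sub_le_of_lipschitz hC hy hz
  have h2 := hf.sub_le_of_lipschitz hC hz hy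
  rw [norm_sub_rev] at h1
  constructor <;> linarith

variable {s : Rn n → S} {W : Finset (Rn n)}

/-- On a trust region of radius `Δ` the model exceeds `f` by at most `O(Δ ^ (q + 1))`. -/
theorem IsMaxRepr.model_le_add (hf : IsMaxRepr q φ f) {R C : ℝ}
    (hC0 : 0 ≤ C) (hC : ∀ s, ∀ y ∈ closedBall (0 : Rn n) R, ∀ z ∈ closedBall (0 : Rn n) R,
      |φ s z - taylorPoly q (φ s) z y| ≤ C * ‖z - y‖ ^ (q + 1))
    {x : Rn n} {Δ : ℝ} (hR : ‖x‖ + Δ ≤ R) (hW : W.Nonempty)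
    (hWΔ : ∀ y ∈ W, y ∈ closedBall x Δ) {z : Rn n} (hz : z ∈ closedBall x Δ) :
    model q φ s W z ≤ f z + C * (2 * Δ) ^ (q + 1) := by
  have hsub : closedBall x Δ ⊆ closedBall 0 R :=
    closedBall_subset_closedBall' (by simpa [add_comm] using hR)
  refine model_le hW fun y hy => ?_
  have h1 := (abs_le.1 (hC (s y) y (hsub (hWΔ y hy)) z (hsub hz))).1
  have h2 := hf.le (s y) z
  have h3 : ‖z - y‖ ≤ 2 * Δ := by
    rw [← dist_eq_norm]
    have := dist_triangle_right z y x
    have := mem_closedBall.1 hz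
    have := mem_closedBall.1 (hWΔ y hy)
    linarith
  have h4 : C * ‖z - y‖ ^ (q + 1) ≤ C * (2 * Δ) ^ (q + 1) := by gcongr
  linarith

/-- Points at which the active Taylor models are inaccurate by a fixed amount cannot accumulate. -/
theorem IsMaxRepr.not_forall_inaccurate [CompactSpace S] (hf : IsMaxRepr q φ f)
    (hs : IsActiveSelection φ f s) {x : Rn n} {r ε : ℝ} (hε : 0 < ε) {z : ℕ → Rn n}
    (hz : ∀ k, z k ∈ closedBall x r) :
    ¬ ∀ k l, k < l → ε < f (z l) - taylorPoly q (φ (s (z k))) (z l) (z k) := by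
  intro h
  set R := ‖x‖ + r
  have hsub : closedBall x r ⊆ closedBall 0 R :=
    closedBall_subset_closedBall' (by simp [R, add_comm])
  obtain ⟨C, hC0, hC⟩ := hf.exists_taylor_bound R
  obtain ⟨L, hL0, hL⟩ := hf.exists_lipschitz_bound R
  obtain ⟨a, -, ψ, hψ, hlim⟩ := (isCompact_closedBall x r).tendsto_subseq hz
  have hdist : Tendsto (fun k => ‖z (ψ (k + 1)) - z (ψ k)‖) atTop (𝓝 0) := by
    simpa using ((hlim.comp (tendsto_add_atTop_nat 1)).sub hlim).norm
  -- With `k` the earlier and `l` the later point, the model error splits as `(f z_l - f z_k) + (φ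
  -- z_k - φ z_l) + (φ z_l - T)`, where `φ` is active at `z_k`. The first two terms cost `L` each,
  -- the last is the Taylor remainder.
  have hbound : Tendsto (fun k => 2 * L * ‖z (ψ (k + 1)) - z (ψ k)‖
      + C * ‖z (ψ (k + 1)) - z (ψ k)‖ ^ (q + 1)) atTop (𝓝 0) := by
    simpa using (hdist.const_mul (2 * L)).add ((hdist.pow (q + 1)).const_mul C)
  obtain ⟨k, hk⟩ := (hbound.eventually_lt_const hε).exists
  have h0 := h _ _ (hψ (Nat.lt_succ_self k))
  have hk0 := hsub (hz (ψ k))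
  have hk1 := hsub (hz (ψ (k + 1)))
  have h1 := (abs_le.1 (hC (s (z (ψ k))) _ hk0 _ hk1)).2
  have h2 := (abs_le.1 (hL (s (z (ψ k))) _ hk0 _ hk1)).1
  have h3 := hf.sub_le_of_lipschitz hL hk0 hk1
  have h4 := hs (z (ψ k))
  simp only [Nat.succ_eq_add_one] at h0
  linarith

end MaxRepr


/-! ### Criticality of accumulation points -/

/-- Small values of `Λ^p` at radii tending to `0` force the accumulation points to be critical. -/
theorem isCritical_of_tendsto_Lam {n : ℕ} {f : Rn n → ℝ} (hf : Continuous f) {p : ℕ}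
    (hp : 1 ≤ p) {x : ℕ → Rn n} {Δ : ℕ → ℝ} (hΔpos : ∀ j, 1 ≤ j → 0 < Δ j)
    (hΔ : Tendsto Δ atTop (𝓝 0))
    (hLam : Tendsto (fun j => Lam f p (x j) (Δ j)) atTop (𝓝 0)) {a : Rn n}
    (ha : MapClusterPt a atTop x) : IsCritical f a := by
  intro v
  rw [inner_zero_left]
  by_contra hlt
  obtain ⟨r, hr, hr0⟩ := EReal.lt_iff_exists_real_btwn.1 (not_le.1 hlt)
  have hr0' : r < 0 := by exact_mod_cast hr0
  have hdesc := eventually_lt_of_limsup_lt hr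
  obtain ⟨P, hP, Q, hQ, hPQ⟩ := eventually_prod_iff.1 hdesc
  have hv : 0 < ‖v‖ + 1 := by positivity
  -- Chosen so that `ε * Δ = -(r * t)` for the step length `t = Δ / (‖v‖ + 1)`, which keeps `x + t •
  -- v` in the trust region; the `+ 1` covers `v = 0`.
  set ε := -r / (‖v‖ + 1) with hε
  have hεpos : 0 < ε := div_pos (by linarith) hv
  have hpos : ∀ᶠ j in atTop, 0 < Δ j := eventually_atTop.2 ⟨1, hΔpos⟩
  have hone : ∀ᶠ j in atTop, Δ j < 1 := hΔ.eventually_lt_const one_pos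
  have htQ : ∀ᶠ j in atTop, Q (Δ j / (‖v‖ + 1)) := by
    refine Tendsto.eventually (tendsto_nhdsWithin_iff.2 ⟨?_, ?_⟩) hQ
    · simpa using hΔ.div_const (‖v‖ + 1)
    · filter_upwards [hpos] with j hj using div_pos hj hv
  have hsmall : ∀ᶠ j in atTop, Lam f p (x j) (Δ j) < ε := hLam.eventually_lt_const hεpos
  obtain ⟨j, hPj, hj0, hj1, hQj, hLj⟩ := ((ha.frequently hP).and_eventually
    (hpos.and (hone.and (htQ.and hsmall)))).exists
  have hq := hPQ hPj hQj
  simp only [EReal.coe_lt_coe_iff] at hq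
  set t := Δ j / (‖v‖ + 1) with ht
  have ht0 : 0 < t := div_pos hj0 hv
  rw [div_lt_iff₀ ht0] at hq
  have hmem : x j + t • v ∈ closedBall (x j) (Δ j) := by
    rw [mem_closedBall, dist_eq_norm, add_sub_cancel_left, norm_smul, Real.norm_of_nonneg ht0.le,
      ht, div_mul_eq_mul_div, div_le_iff₀ hv]
    nlinarith
  have hinf : sInf (f '' closedBall (x j) (Δ j)) ≤ f (x j + t • v) :=
    csInf_le ((isCompact_closedBall _ _).image hf).bddBelow ⟨_, hmem, rfl⟩
  rw [Lam, div_lt_iff₀ (pow_pos hj0 p)] at hLj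
  have hpow : Δ j ^ p ≤ Δ j := by
    simpa using pow_le_pow_of_le_one hj0.le hj1.le hp
  have h1 : ε * Δ j ^ p ≤ ε * Δ j := by gcongr
  have h2 : ε * Δ j = -(r * t) := by rw [hε, ht]; ring
  linarith

/-! ### Executions: invariant, termination, bound on `Λ^p` -/

section Execution

variable {n : ℕ} {S : Type*} {p q : ℕ} {φ : S → Rn n → ℝ} {s : Rn n → S} {f : Rn n → ℝ}
  {σ c : ℝ} {Δ τ : ℕ → ℝ} {x₀ : Rn n}

/-- The invariant of the method: the bundle contains the iterate and lies in the trust region, and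
the iterate lies in the initial sublevel set. -/
structure State.Valid (f : Rn n → ℝ) (Δ : ℕ → ℝ) (x₀ : Rn n) (a : State n) : Prop where
  one_le : 1 ≤ a.j
  mem : a.x ∈ a.W
  subset : ∀ y ∈ a.W, y ∈ closedBall a.x (Δ a.j)
  le : f a.x ≤ f x₀

theorem State.valid_singleton (hΔpos : ∀ j, 1 ≤ j → 0 < Δ j) {j : ℕ} (hj : 1 ≤ j) {x : Rn n}
    (hx : f x ≤ f x₀) : (⟨j, x, {x}⟩ : State n).Valid f Δ x₀ where
  one_le := hj
  mem := Finset.mem_singleton_self x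
  subset y hy := by
    rw [Finset.mem_singleton.1 hy]
    exact mem_closedBall_self (hΔpos j hj).le
  le := hx

theorem le_sub_of_not_div_lt {u v d t : ℝ} (hd : 0 < d) (h : ¬ (u - v) / d < t) :
    v ≤ u - t * d := by
  rw [not_lt, le_div_iff₀ hd] at h
  linarith

theorem Step.valid (hΔpos : ∀ j, 1 ≤ j → 0 < Δ j) (hτpos : ∀ j, 1 ≤ j → 0 < τ j)
    {a b : State n} (h : Step p q φ s f σ c Δ τ a b) (ha : a.Valid f Δ x₀) :
    b.Valid f Δ x₀ := by
  obtain ⟨z, hz, ⟨-, rfl⟩ | ⟨-, -, rfl⟩ | ⟨-, hd, rfl⟩⟩ := h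
  · refine ⟨ha.one_le, Finset.mem_insert_of_mem ha.mem, fun y hy => ?_, ha.le⟩
    rcases Finset.mem_insert.1 hy with rfl | hy
    exacts [hz.1, ha.subset y hy]
  · exact State.valid_singleton hΔpos (Nat.le_succ_of_le ha.one_le) ha.le
  · have hpow := pow_pos (hΔpos _ ha.one_le) p
    have := le_sub_of_not_div_lt hpow hd
    have := mul_pos (hτpos _ ha.one_le) hpow
    exact State.valid_singleton hΔpos ha.one_le (by linarith [ha.le])

theorem State.Valid.exists_step (hΔpos : ∀ j, 1 ≤ j → 0 < Δ j) {a : State n}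
    (ha : a.Valid f Δ x₀) : ∃ b, Step p q φ s f σ c Δ τ a b := by
  obtain ⟨z, hz⟩ := exists_isSubproblemSol (q := q) (φ := φ) (s := s) ⟨_, ha.mem⟩ a.x
    (hΔpos _ ha.one_le).le
  by_cases h1 : ModelAccurate q φ s f σ c (Δ a.j) a.W z
  · by_cases h2 : (f a.x - f z) / Δ a.j ^ p < τ a.j
    · exact ⟨_, z, hz, Or.inr (Or.inl ⟨h1, h2, rfl⟩)⟩
    · exact ⟨_, z, hz, Or.inr (Or.inr ⟨h1, h2, rfl⟩)⟩
  · exact ⟨_, z, hz, Or.inl ⟨h1, rfl⟩⟩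

theorem exists_isExecution (hΔpos : ∀ j, 1 ≤ j → 0 < Δ j) (hτpos : ∀ j, 1 ≤ j → 0 < τ j) :
    ∃ e, IsExecution p q φ s f σ c Δ τ x₀ e := by
  choose! next hnext using fun (a : State n) (ha : a.Valid f Δ x₀) =>
    ha.exists_step (p := p) (q := q) (φ := φ) (s := s) (σ := σ) (c := c) (τ := τ) hΔpos
  let e : ℕ → State n := fun t => next^[t] ⟨1, x₀, {x₀}⟩
  have hsucc : ∀ t, e (t + 1) = next (e t) := fun t => Function.iterate_succ_apply' next t _
  have hvalid : ∀ t, (e t).Valid f Δ x₀ := by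
    intro t
    induction t with
    | zero => exact State.valid_singleton hΔpos le_rfl le_rfl
    | succ t ih =>
      rw [hsucc]
      exact (hnext _ ih).valid hΔpos hτpos ih
  refine ⟨e, rfl, fun t => ?_⟩
  rw [hsucc]
  exact hnext _ (hvalid t)

theorem IsExecution.valid {e : ℕ → State n} (he : IsExecution p q φ s f σ c Δ τ x₀ e)
    (hΔpos : ∀ j, 1 ≤ j → 0 < Δ j) (hτpos : ∀ j, 1 ≤ j → 0 < τ j) (t : ℕ) :
    (e t).Valid f Δ x₀ := by
  induction t with
  | zero =>
    rw [he.1]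
    exact State.valid_singleton hΔpos le_rfl le_rfl
  | succ t ih => exact (he.2 t).valid hΔpos hτpos ih

theorem Step.j_eq_or {a b : State n} (h : Step p q φ s f σ c Δ τ a b) :
    b.j = a.j ∨ b.j = a.j + 1 := by
  obtain ⟨z, hz, ⟨-, rfl⟩ | ⟨-, -, rfl⟩ | ⟨-, -, rfl⟩⟩ := h
  exacts [Or.inl rfl, Or.inr rfl, Or.inl rfl]

/-- A step within an inner loop enlarges the bundle or decreases `f` by a fixed amount. -/
theorem Step.insert_or_decrease {a b : State n} (h : Step p q φ s f σ c Δ τ a b)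
    (hΔ : 0 < Δ a.j) (hj : b.j = a.j) :
    (∃ z ∈ closedBall a.x (Δ a.j), ¬ ModelAccurate q φ s f σ c (Δ a.j) a.W z ∧
      b = ⟨a.j, a.x, insert z a.W⟩) ∨ f b.x ≤ f a.x - τ a.j * Δ a.j ^ p := by
  obtain ⟨z, hz, ⟨hacc, rfl⟩ | ⟨-, -, rfl⟩ | ⟨-, hd, rfl⟩⟩ := h
  · exact Or.inl ⟨z, hz.1, hacc, rfl⟩
  · simp at hj
  · exact Or.inr (le_sub_of_not_div_lt (pow_pos hΔ p) hd)

/-- The step that leaves an inner loop comes with a minimizer of an accurate model at which `f`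
decreases by less than the tolerance. -/
theorem Step.exists_accurate_of_succ {a b : State n} (h : Step p q φ s f σ c Δ τ a b)
    (hj : b.j = a.j + 1) :
    ∃ z, IsSubproblemSol q φ s a.W a.x (Δ a.j) z ∧ ModelAccurate q φ s f σ c (Δ a.j) a.W z ∧
      (f a.x - f z) / Δ a.j ^ p < τ a.j := by
  obtain ⟨z, hz, ⟨hacc, rfl⟩ | ⟨hacc, hd, rfl⟩ | ⟨-, hd, rfl⟩⟩ := h
  · simp at hj
  · exact ⟨z, hz, hacc, hd⟩
  · simp at hj

variable {e : ℕ → State n}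

theorem IsExecution.monotone_j (he : IsExecution p q φ s f σ c Δ τ x₀ e) :
    Monotone fun t => (e t).j :=
  monotone_nat_of_le_succ fun t => by rcases (he.2 t).j_eq_or with h | h <;> simp [h]

theorem IsExecution.isOuterIterate_unique (he : IsExecution p q φ s f σ c Δ τ x₀ e) {j : ℕ}
    {y y' : Rn n} (hy : IsOuterIterate e j y) (hy' : IsOuterIterate e j y') : y = y' := by
  obtain ⟨t, h1, h2, rfl⟩ := hy
  obtain ⟨t', h1', h2', rfl⟩ := hy'
  have hle : ∀ {u v : ℕ}, (e u).j = j → (e (v + 1)).j = j + 1 → u ≤ v := by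
    intro u v hu hv
    by_contra hlt
    have : (e (v + 1)).j ≤ (e u).j := he.monotone_j (not_le.1 hlt)
    omega
  have heq : t = t' := le_antisymm (hle h1 h2') (hle h1' h2)
  rw [heq]

/-- The bundle subroutine cannot enlarge the bundle forever. -/
theorem IsExecution.not_eventually_insert [TopologicalSpace S] [CompactSpace S]
    (hf : IsMaxRepr q φ f) (hs : IsActiveSelection φ f s) {j : ℕ} (hΔ : 0 < Δ j) (hc : 0 < c)
    {t₀ : ℕ} (hj : ∀ t ≥ t₀, (e t).j = j) :
    ¬ ∀ t ≥ t₀, ∃ z ∈ closedBall (e t).x (Δ (e t).j),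
      ¬ ModelAccurate q φ s f σ c (Δ (e t).j) (e t).W z ∧
        e (t + 1) = ⟨(e t).j, (e t).x, insert z (e t).W⟩ := by
  intro h
  choose z hzmem hzacc hze using fun k => h (t₀ + k) (Nat.le_add_right _ _)
  have hj' : ∀ k, (e (t₀ + k)).j = j := fun k => hj _ (Nat.le_add_right _ _)
  have hx : ∀ k, (e (t₀ + k)).x = (e t₀).x := by
    intro k
    induction k with
    | zero => rfl
    | succ k ih => rw [← add_assoc, hze k, ← ih]
  have hmono : Monotone fun k => (e (t₀ + k)).W := by
    refine monotone_nat_of_le_succ fun k => ?_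
    rw [← add_assoc, hze k]
    exact Finset.subset_insert _ _
  have hmem : ∀ k l, k < l → z k ∈ (e (t₀ + l)).W := by
    intro k l hkl
    refine hmono (Nat.succ_le_of_lt hkl) ?_
    simp only [Nat.succ_eq_add_one]
    rw [← add_assoc, hze k]
    exact Finset.mem_insert_self _ _
  refine hf.not_forall_inaccurate hs (x := (e t₀).x) (r := Δ j)
    (ε := min (Δ j ^ ((q : ℝ) + σ)) c) (lt_min (Real.rpow_pos_of_pos hΔ _) hc) (z := z)
    (fun k => by simpa [hx, hj'] using hzmem k) fun k l hkl => ?_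
  have h1 := hzacc l
  rw [ModelAccurate, not_le, hj'] at h1
  have h2 := taylorPoly_le_model (q := q) (φ := φ) (s := s) (hmem k l hkl) (z l)
  linarith

/-- Every inner loop is left. -/
theorem IsExecution.exists_succ_j [TopologicalSpace S] [CompactSpace S]
    (he : IsExecution p q φ s f σ c Δ τ x₀ e) (hf : IsMaxRepr q φ f)
    (hs : IsActiveSelection φ f s) (hΔpos : ∀ j, 1 ≤ j → 0 < Δ j)
    (hτpos : ∀ j, 1 ≤ j → 0 < τ j) (hc : 0 < c) {m : ℝ} (hm : ∀ x, f x ≤ f x₀ → m ≤ f x)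
    (t₀ : ℕ) : ∃ t ≥ t₀, (e (t + 1)).j = (e t).j + 1 := by
  by_contra! hcon
  have hstep : ∀ t ≥ t₀, (e (t + 1)).j = (e t).j := fun t ht =>
    (he.2 t).j_eq_or.resolve_right (hcon t ht)
  have hvalid := he.valid hΔpos hτpos
  have hconst : ∀ t ≥ t₀, (e t).j = (e t₀).j := by
    intro t ht
    induction t, ht using Nat.le_induction with
    | base => rfl
    | succ t ht ih => rw [hstep t ht, ih]
  have hj1 := (hvalid t₀).one_le
  set j := (e t₀).j
  have hΔj := hΔpos j hj1
  set δ := τ j * Δ j ^ p with hδ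
  have hδpos : 0 < δ := mul_pos (hτpos j hj1) (pow_pos hΔj p)
  have halt : ∀ t ≥ t₀, (∃ z ∈ closedBall (e t).x (Δ (e t).j),
      ¬ ModelAccurate q φ s f σ c (Δ (e t).j) (e t).W z ∧
        e (t + 1) = ⟨(e t).j, (e t).x, insert z (e t).W⟩) ∨
      f (e (t + 1)).x ≤ f (e t).x - δ := by
    intro t ht
    have := (he.2 t).insert_or_decrease (hΔpos _ (hvalid t).one_le) (hstep t ht)
    rwa [hconst t ht, ← hδ, ← hconst t ht] at this
  have hanti : Antitone fun k => f (e (t₀ + k)).x := by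
    refine antitone_nat_of_succ_le fun k => ?_
    rcases halt (t₀ + k) (Nat.le_add_right _ _) with ⟨z, -, -, hz⟩ | h
    · rw [← add_assoc, hz]
    · rw [← add_assoc]
      linarith
  have hlim := tendsto_atTop_ciInf hanti
    ⟨m, by rintro _ ⟨k, rfl⟩; exact hm _ (hvalid _).le⟩
  -- The values of `f` converge, so decreases by `δ` eventually stop and only bundle insertions
  -- remain.
  have hdiff : Tendsto (fun k => f (e (t₀ + k)).x - f (e (t₀ + (k + 1))).x) atTop (𝓝 0) := by
    simpa using hlim.sub (hlim.comp (tendsto_add_atTop_nat 1))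
  obtain ⟨N, hN⟩ := eventually_atTop.1 (hdiff.eventually_lt_const hδpos)
  refine IsExecution.not_eventually_insert (e := e) (t₀ := t₀ + N) (σ := σ) hf hs hΔj hc
    (fun t ht => hconst t (le_trans (Nat.le_add_right _ _) ht)) fun t ht => ?_
  obtain ⟨k, rfl⟩ := Nat.exists_eq_add_of_le (le_trans (Nat.le_add_right _ _) ht)
  refine (halt _ (Nat.le_add_right _ _)).resolve_right fun h => ?_
  have := hN k (by omega)
  rw [← add_assoc] at this
  linarith

/-- The outer index grows by at most one per step and never stalls, so it takes every value `j ≥ 1`;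
the first exit after reaching `j` happens at index `j`. -/
theorem IsExecution.exists_isOuterIterate [TopologicalSpace S] [CompactSpace S]
    (he : IsExecution p q φ s f σ c Δ τ x₀ e) (hf : IsMaxRepr q φ f)
    (hs : IsActiveSelection φ f s) (hΔpos : ∀ j, 1 ≤ j → 0 < Δ j)
    (hτpos : ∀ j, 1 ≤ j → 0 < τ j) (hc : 0 < c) {m : ℝ} (hm : ∀ x, f x ≤ f x₀ → m ≤ f x)
    {j : ℕ} (hj : 1 ≤ j) : ∃ y, IsOuterIterate e j y := by
  have hexit := he.exists_succ_j hf hs hΔpos hτpos hc hm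
  have hreach : ∃ t, (e t).j = j := by
    induction j, hj using Nat.le_induction with
    | base => exact ⟨0, by rw [he.1]⟩
    | succ j hj ih =>
      obtain ⟨t, rfl⟩ := ih
      classical
      obtain ⟨t', ht', hsucc⟩ := hexit t
      have hex : ∃ u, (e t).j < (e u).j :=
        ⟨t' + 1, by have : (e t).j ≤ (e t').j := he.monotone_j ht'; omega⟩
      refine ⟨Nat.find hex, ?_⟩
      have hspec := Nat.find_spec hex
      obtain ⟨u, hu⟩ : ∃ u, Nat.find hex = u + 1 := by
        refine Nat.exists_eq_succ_of_ne_zero fun h0 => ?_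
        rw [h0] at hspec
        have : (e 0).j ≤ (e t).j := he.monotone_j (Nat.zero_le t)
        omega
      have hmin := Nat.find_min hex (m := u) (by omega)
      rw [hu] at hspec ⊢
      rcases (he.2 u).j_eq_or with h | h <;> omega
  classical
  obtain ⟨t, rfl⟩ := hreach
  obtain ⟨t', ht', hsucc⟩ := hexit t
  have hex : ∃ u, t ≤ u ∧ (e (u + 1)).j = (e u).j + 1 := ⟨t', ht', hsucc⟩
  obtain ⟨hle, hnext⟩ := Nat.find_spec hex
  have hconst : ∀ u ≥ t, u ≤ Nat.find hex → (e u).j = (e t).j := by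
    intro u hu
    induction u, hu using Nat.le_induction with
    | base => exact fun _ => rfl
    | succ u hu ih =>
      intro hlt
      have hno := Nat.find_min hex (m := u) (by omega)
      rw [← ih (by omega)]
      exact (he.2 u).j_eq_or.resolve_right fun h => hno ⟨hu, h⟩
  have hj' := hconst _ hle le_rfl
  exact ⟨_, Nat.find hex, hj', by rw [hnext, hj'], rfl⟩

theorem IsExecution.le_of_isOuterIterate (he : IsExecution p q φ s f σ c Δ τ x₀ e)
    (hΔpos : ∀ j, 1 ≤ j → 0 < Δ j) (hτpos : ∀ j, 1 ≤ j → 0 < τ j) {j : ℕ} {y : Rn n}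
    (hy : IsOuterIterate e j y) : f y ≤ f x₀ := by
  obtain ⟨t, -, -, rfl⟩ := hy
  exact (he.valid hΔpos hτpos t).le

theorem Lam_nonneg (hf : Continuous f) (p : ℕ) (x : Rn n) {r : ℝ} (hr : 0 ≤ r) :
    0 ≤ Lam f p x r := by
  have h : sInf (f '' closedBall x r) ≤ f x :=
    csInf_le ((isCompact_closedBall _ _).image hf).bddBelow ⟨x, mem_closedBall_self hr, rfl⟩
  exact div_nonneg (by linarith) (by positivity)

/-- The bound on `Λ^p` at the outer iterates. -/
theorem IsExecution.Lam_le [TopologicalSpace S] [CompactSpace S]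
    (he : IsExecution p q φ s f σ c Δ τ x₀ e) (hf : IsMaxRepr q φ f) (hpq : p ≤ q)
    (hΔpos : ∀ j, 1 ≤ j → 0 < Δ j) (hτpos : ∀ j, 1 ≤ j → 0 < τ j) {R C : ℝ} (hC0 : 0 ≤ C)
    (hC : ∀ s, ∀ y ∈ closedBall (0 : Rn n) R, ∀ z ∈ closedBall (0 : Rn n) R,
      |φ s z - taylorPoly q (φ s) z y| ≤ C * ‖z - y‖ ^ (q + 1))
    {j : ℕ} {y : Rn n} (hy : IsOuterIterate e j y) (hyR : ‖y‖ + 1 ≤ R) (hΔ1 : Δ j ≤ 1) :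
    Lam f p y (Δ j) ≤ τ j + Δ j ^ σ + C * 2 ^ (q + 1) * Δ j := by
  obtain ⟨t, rfl, hsucc, rfl⟩ := hy
  have hvalid := he.valid hΔpos hτpos t
  have hΔ0 := hΔpos _ hvalid.one_le
  obtain ⟨z, hz, hacc, hd⟩ := (he.2 t).exists_accurate_of_succ hsucc
  -- Compare with a true minimizer `w` of `f`: `f z - Δ ^ (q + σ) ≤ model z ≤ model w ≤ f w + C * (2
  -- * Δ) ^ (q + 1)`.
  obtain ⟨w, hw, hwmin⟩ := (isCompact_closedBall (e t).x (Δ (e t).j)).exists_isMinOn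
    ⟨_, mem_closedBall_self hΔ0.le⟩ hf.continuous.continuousOn
  rw [Lam_eq hw hwmin]
  have h1 := hf.model_le_add (s := s) hC0 hC (by linarith) ⟨_, hvalid.mem⟩ hvalid.subset hw
  have h2 : model q φ s (e t).W z ≤ model q φ s (e t).W w := hz.2 hw
  have h3 := hacc.trans (min_le_left _ _)
  set d := Δ (e t).j
  have hdp : 0 < d ^ p := pow_pos hΔ0 p
  rw [div_lt_iff₀ hdp] at hd
  rw [div_le_iff₀ hdp]
  have hqp : d ^ q ≤ d ^ p := pow_le_pow_of_le_one hΔ0.le hΔ1 hpq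
  have h4 : d ^ ((q : ℝ) + σ) ≤ d ^ σ * d ^ p := by
    rw [Real.rpow_add hΔ0, Real.rpow_natCast, mul_comm]
    gcongr
  have h5 : C * (2 * d) ^ (q + 1) ≤ C * 2 ^ (q + 1) * d * d ^ p := by
    have : C * (2 * d) ^ (q + 1) = C * 2 ^ (q + 1) * d * d ^ q := by ring
    rw [this]
    gcongr
  nlinarith

end Execution

end TRBundle

/-! ### The main theorem -/

theorem mainTheorem1 {n : ℕ} {S : Type*} [TopologicalSpace S] [CompactSpace S]
    (p q : ℕ) (hp : 1 ≤ p) (hpq : p ≤ q)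
    (f : TRBundle.Rn n → ℝ) (φ : S → TRBundle.Rn n → ℝ) (hf : TRBundle.IsMaxRepr q φ f)
    (s : TRBundle.Rn n → S) (hs : TRBundle.IsActiveSelection φ f s)
    (Δ τ : ℕ → ℝ) (hΔpos : ∀ j, 1 ≤ j → 0 < Δ j) (hΔ : Tendsto Δ atTop (𝓝 0))
    (hτpos : ∀ j, 1 ≤ j → 0 < τ j) (hτ : Tendsto τ atTop (𝓝 0))
    (σ c : ℝ) (hσ : σ ∈ Set.Ioo (0 : ℝ) 1) (hc : 0 < c)
    (x₀ : TRBundle.Rn n) (hbdd : Bornology.IsBounded {x | f x ≤ f x₀}) :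
    -- the method can be carried out
    (∃ e, TRBundle.IsExecution p q φ s f σ c Δ τ x₀ e) ∧
    ∀ e, TRBundle.IsExecution p q φ s f σ c Δ τ x₀ e →
      -- all inner loops terminate, and determine the sequence of outer iterates
      (∀ j, 1 ≤ j → ∃! y, TRBundle.IsOuterIterate e j y) ∧
      ∀ x : ℕ → TRBundle.Rn n, (∀ j, 1 ≤ j → TRBundle.IsOuterIterate e j (x j)) →
        Tendsto (fun j => TRBundle.Lam f p (x j) (Δ j)) atTop (𝓝 0) ∧
        (∃ a, MapClusterPt a atTop x) ∧
        ∀ a, MapClusterPt a atTop x → TRBundle.IsCritical f a := by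
  have hcompact : IsCompact {x | f x ≤ f x₀} :=
    Metric.isCompact_of_isClosed_isBounded (isClosed_le hf.continuous continuous_const) hbdd
  obtain ⟨m, hm⟩ := (hcompact.image hf.continuous).bddBelow
  obtain ⟨R, hR⟩ := hbdd.exists_norm_le
  -- Radius `R + 1` contains every trust region of radius at most `1` centred in the sublevel set.
  obtain ⟨C, hC0, hC⟩ := hf.exists_taylor_bound (R + 1)
  refine ⟨TRBundle.exists_isExecution hΔpos hτpos, fun e he => ⟨fun j hj => ?_, fun x hx => ?_⟩⟩
  · obtain ⟨y, hy⟩ := he.exists_isOuterIterate hf hs hΔpos hτpos hc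
      (fun x hx => hm ⟨x, hx, rfl⟩) hj
    exact ⟨y, hy, fun y' hy' => he.isOuterIterate_unique hy' hy⟩
  have hsub : ∀ j, 1 ≤ j → x j ∈ {x | f x ≤ f x₀} := fun j hj =>
    he.le_of_isOuterIterate hΔpos hτpos (hx j hj)
  have hlim : Tendsto (fun j => TRBundle.Lam f p (x j) (Δ j)) atTop (𝓝 0) := by
    have hbound : Tendsto (fun j => τ j + Δ j ^ σ + C * 2 ^ (q + 1) * Δ j) atTop (𝓝 0) := by
      have h := (hτ.add (hΔ.rpow_const (p := σ) (Or.inr hσ.1.le))).add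
        (hΔ.const_mul (C * 2 ^ (q + 1)))
      simpa [Real.zero_rpow hσ.1.ne'] using h
    refine tendsto_of_tendsto_of_tendsto_of_le_of_le' tendsto_const_nhds hbound ?_ ?_
    · filter_upwards [eventually_ge_atTop 1] with j hj
      exact TRBundle.Lam_nonneg hf.continuous p (x j) (hΔpos j hj).le
    · filter_upwards [eventually_ge_atTop 1, hΔ.eventually_le_const one_pos] with j hj hj1
      exact he.Lam_le hf hpq hΔpos hτpos hC0 hC (hx j hj) (by linarith [hR _ (hsub j hj)]) hj1
  refine ⟨hlim, ?_, fun a ha =>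
    TRBundle.isCritical_of_tendsto_Lam hf.continuous hp hΔpos hΔ hlim ha⟩
  obtain ⟨a, -, ha⟩ := hcompact.exists_mapClusterPt
    (tendsto_principal.2 (eventually_atTop.2 ⟨1, hsub⟩))
  exact ⟨a, ha⟩
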